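/- Let $d \ge 1$ and let $\mathbb C^d[z]$ be the complex vector space of $d\times 1$ vector polynomials. A finite dimensional Pontryagin space is a finite dimensional complex vector space with a Hermitian form $[\cdot,\cdot]$, linear in the first variable, such that the space is the orthogonal direct sum of a subspace on which the form is positive definite and one on which it is negative definite. For a subspace $\mathfrak B\subset\mathbb C^d[z]$ that is a finite dimensional Pontryagin space with inner product $[\cdot,\cdot]_{\mathfrak B}$, its reproducing kernel is the unique function $K:\mathbb C\times\mathbb C\to\mathbb C^{d\times d}$ such that $K(\cdot,w)x\in\mathfrak B$ and $[f,K(\cdot,w)x]_{\mathfrak B}=x^*f(w)$ for all $w\in\mathbb C$, $x\in\mathbb C^d$, $f\in\mathfrak B$. It is called a (polynomial) Nevanlinna kernel if there are $d\times d$ matrix polynomials $M(z)$, $N(z)$ such that $$K(z,w)=\frac{M(z)N(w)^*-N(z)M(w)^*}{z-\overline{w}}\quad\text{for all } z,w\in\mathbb C,\ z\neq\overline{w},$$ $M(z)N(\overline z)^*-N(z)M(\overline z)^*=0$ for all $z\in\mathbb C$, and $\operatorname{rank}[M(z)\ N(z)]=d$ for at least one $z\in\mathbb C$. For a subspace $\mathfrak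 B$ of $\mathbb C^d[z]$, let $S_{\mathfrak B}$ be the operator $(S_{\mathfrak B}f)(z)=zf(z)$ in $\mathfrak B$ with domain $\{f\in\mathfrak B: zf(z)\in\mathfrak B\}$, and let $E_\alpha f=f(\alpha)$ for $\alpha\in\mathbb C$. Let $\mathfrak B\subset\mathbb C^d[z]$ be a finite dimensional Pontryagin space whose reproducing kernel is a Nevanlinna kernel, and let $\mathfrak B_0$ be a Pontryagin subspace of $\mathfrak B$, that is, a linear subspace of $\mathfrak B$ which is a Pontryagin space in the inner product inherited from $\mathfrak B$. Then the reproducing kernel of $\mathfrak B_0$ is a Nevanlinna kernel if and only if there is an $\alpha\in\mathbb C$ such that $$\operatorname{ran}(S_{\mathfrak B_0}-\alpha)=\mathfrak B_0\cap\ker E_\alpha .$$ -/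

import Mathlib

open Polynomial

/-- `ℂ^d[z]`: the complex vector space of `d × 1` vector polynomials. -/
abbrev VecPoly (d : ℕ) : Type := Fin d → ℂ[X]

/-- The evaluation operator `f ↦ f(α)` from `ℂ^d[z]` to `ℂ^d`. -/
noncomputable def evalAt (d : ℕ) (α : ℂ) : VecPoly d →ₗ[ℂ] (Fin d → ℂ) where
  toFun f := fun i => (f i).eval α
  map_add' f g := by ext i; simp
  map_smul' c f := by ext i; simp

/-- Multiplication by the independent variable, `f(z) ↦ z f(z)`, on `ℂ^d[z]`. -/
noncomputable def mulVar (d : ℕ) : VecPoly d →ₗ[ℂ] VecPoly d where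
  toFun f := fun i => X * f i
  map_add' f g := by ext1 i; simp [mul_add]
  map_smul' c f := by ext1 i; simp

/-- The domain `{f ∈ B : z f(z) ∈ B}` of the multiplication operator in `B`. -/
noncomputable def multDom {d : ℕ} (B : Submodule ℂ (VecPoly d)) : Submodule ℂ (VecPoly d) :=
  B ⊓ B.comap (mulVar d)

/-- The operator `S_B` of multiplication by the independent variable in `B`, as an operator in `B`
with domain `{f ∈ B : z f(z) ∈ B}`. -/
noncomputable def multOp {d : ℕ} (B : Submodule ℂ (VecPoly d)) : multDom B →ₗ[ℂ] B :=
  ((mulVar d).domRestrict (multDom B)).codRestrict B (fun f => f.2.2)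

/-- The range of `S_B - α`, as a subspace of `B`. -/
noncomputable def ranMultOpSub {d : ℕ} (B : Submodule ℂ (VecPoly d)) (α : ℂ) : Submodule ℂ B :=
  LinearMap.range (multOp B - α • Submodule.inclusion (show multDom B ≤ B from inf_le_left))

/-- `B ∩ ker E_α`, as a subspace of `B`. -/
noncomputable def kerEval {d : ℕ} (B : Submodule ℂ (VecPoly d)) (α : ℂ) : Submodule ℂ B :=
  LinearMap.ker ((evalAt d α).domRestrict B)

/-- The form `φ` (linear in the first and conjugate linear in the second variable) makes `V` a
finite dimensional Pontryagin space: `φ` is Hermitian and `V` has a fundamental decomposition, that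
is, `V` is the `φ`-orthogonal direct sum of a subspace on which `φ` is positive definite and a
subspace on which `φ` is negative definite (completeness of both is automatic here). -/
structure IsFinDimPontryagin {V : Type*} [AddCommGroup V] [Module ℂ V]
    (φ : V →ₗ[ℂ] V →ₗ⋆[ℂ] ℂ) : Prop where
  finiteDimensional : FiniteDimensional ℂ V
  hermitian : ∀ f g : V, φ g f = star (φ f g)
  fundamental_decomposition : ∃ Vp Vm : Submodule ℂ V, IsCompl Vp Vm ∧
    (∀ f ∈ Vp, ∀ g ∈ Vm, φ f g = 0) ∧
    (∀ f ∈ Vp, f ≠ 0 → 0 < (φ f f).re) ∧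
    (∀ f ∈ Vm, f ≠ 0 → (φ f f).re < 0)

/-- The inner product of `B` restricted to a subspace `B₀ ⊆ B`. -/
noncomputable def restrictForm {d : ℕ} {B B₀ : Submodule ℂ (VecPoly d)} (h : B₀ ≤ B)
    (φ : B →ₗ[ℂ] B →ₗ⋆[ℂ] ℂ) : B₀ →ₗ[ℂ] B₀ →ₗ⋆[ℂ] ℂ :=
  LinearMap.mk₂'ₛₗ (RingHom.id ℂ) (starRingEnd ℂ)
    (fun f g => φ (Submodule.inclusion h f) (Submodule.inclusion h g))
    (by intros; simp) (by intros; simp) (by intros; simp) (by intros; simp)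

/-- `K` is the reproducing kernel of `B` with inner product `φ`: for all `w ∈ ℂ` and `x ∈ ℂ^d` the
function `z ↦ K(z,w) x` belongs to `B` and `[f, K(·,w) x] = x^* f(w)` for all `f ∈ B`. -/
def IsReproducingKernel {d : ℕ} (B : Submodule ℂ (VecPoly d)) (φ : B →ₗ[ℂ] B →ₗ⋆[ℂ] ℂ)
    (K : ℂ → ℂ → Matrix (Fin d) (Fin d) ℂ) : Prop :=
  ∀ (w : ℂ) (x : Fin d → ℂ), ∃ k : B,
    (∀ z : ℂ, evalAt d z k = (K z w).mulVec x) ∧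
    ∀ f : B, φ f k = dotProduct (star x) (evalAt d w f)

/-- The value `M(z)` of a matrix polynomial. -/
noncomputable def matEval {d : ℕ} (M : Matrix (Fin d) (Fin d) ℂ[X]) (z : ℂ) :
    Matrix (Fin d) (Fin d) ℂ :=
  M.map (Polynomial.eval z)

open scoped Matrix in
/-- `K` is a polynomial Nevanlinna kernel: there are `d × d` matrix polynomials `M`, `N` with
`K(z,w) = (M(z) N(w)^* - N(z) M(w)^*) / (z - w^*)` for `z ≠ w^*`,
`M(z) N(z^*)^* - N(z) M(z^*)^* = 0` for all `z`, and `rank [M(z) N(z)] = d` for some `z`. -/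
def IsNevanlinnaKernel {d : ℕ} (K : ℂ → ℂ → Matrix (Fin d) (Fin d) ℂ) : Prop :=
  ∃ M N : Matrix (Fin d) (Fin d) ℂ[X],
    (∀ z w : ℂ, z ≠ star w →
      K z w = (z - star w)⁻¹ • (matEval M z * (matEval N w)ᴴ - matEval N z * (matEval M w)ᴴ)) ∧
    (∀ z : ℂ, matEval M z * (matEval N (star z))ᴴ - matEval N z * (matEval M (star z))ᴴ = 0) ∧
    ∃ z : ℂ, (Matrix.fromCols (matEval M z) (matEval N z)).rank = d

/-- The (unique) reproducing kernel of `B` with inner product `φ` is a polynomial Nevanlinna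
kernel. -/
def HasNevanlinnaReproducingKernel {d : ℕ} (B : Submodule ℂ (VecPoly d))
    (φ : B →ₗ[ℂ] B →ₗ⋆[ℂ] ℂ) : Prop :=
  ∃ K : ℂ → ℂ → Matrix (Fin d) (Fin d) ℂ, IsReproducingKernel B φ K ∧ IsNevanlinnaKernel K

/-! The range condition says that an element of the space vanishing at `α` can be divided by `z - α`
within the space. A Nevanlinna kernel amounts to this condition at a real point together with
symmetry of multiplication by `z`. Symmetry passes to every subspace, so for `B₀` only the range
condition is left to decide. From kernel to division: kernel functions span the space, and the
kernel formula writes each `f` as `(z - β) g + M a - N b`. If `f(β) = 0`, the Lagrangian property of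
`(M(β), N(β))` turns `M a - N b` into `(z - β) K(·, β) y`, so `z - β` divides `f`; the reproducing
property makes the division symmetric (`exists_real_symmetric_division`). From division to kernel: a
dimension count moves `α` to a real `β`, and Green's identity for the division operator yields
explicit `M`, `N` (`hasNevanlinnaReproducingKernel_of_range`). -/

/-! ### Duality in finite dimensional Pontryagin spaces -/

/-- A Hermitian form with a fundamental decomposition is nondegenerate. -/
theorem IsFinDimPontryagin.eq_zero_of_forall {V : Type*} [AddCommGroup V] [Module ℂ V]
    {φ : V →ₗ[ℂ] V →ₗ⋆[ℂ] ℂ} (hφ : IsFinDimPontryagin φ) {g : V} (hg : ∀ f, φ f g = 0) :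
    g = 0 := by
  obtain ⟨Vp, Vm, hc, ho, hp, hm⟩ := hφ.fundamental_decomposition
  obtain ⟨a, ha, b, hb, rfl⟩ := Submodule.mem_sup.1
    (show g ∈ Vp ⊔ Vm by rw [hc.sup_eq_top]; trivial)
  have h1 : φ a a = 0 := by simpa [ho a ha b hb] using hg a
  have hba : φ b a = 0 := by rw [hφ.hermitian a b, ho a ha b hb, star_zero]
  have h2 : φ b b = 0 := by simpa [hba] using hg b
  have ha0 : a = 0 := by
    by_contra h
    simpa [h1] using hp a ha h
  have hb0 : b = 0 := by
    by_contra h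
    simpa [h2] using hm b hb h
  rw [ha0, hb0, add_zero]

/-- Riesz representation in a finite dimensional Pontryagin space. -/
theorem IsFinDimPontryagin.exists_representative {V : Type*} [AddCommGroup V] [Module ℂ V]
    {φ : V →ₗ[ℂ] V →ₗ⋆[ℂ] ℂ} (hφ : IsFinDimPontryagin φ) (ℓ : V →ₗ[ℂ] ℂ) :
    ∃ k, ∀ f, φ f k = ℓ f := by
  have := hφ.finiteDimensional
  -- The map `k ↦ φ(·, k)` is conjugate linear, so dimensions are compared over the reals, where it
  -- is linear.
  let : Module ℝ V := Module.complexToReal V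
  have : FiniteDimensional ℝ V := FiniteDimensional.complexToReal V
  let Φ : V →ₗ[ℝ] Module.Dual ℂ V :=
    { toFun := fun k => φ.flip k
      map_add' := fun a b => by ext f; simp
      map_smul' := fun c a => by
        ext f
        have h : φ f ((c : ℂ) • a) = starRingEnd ℂ (c : ℂ) * φ f a := (φ f).map_smulₛₗ _ _
        rw [Complex.conj_ofReal] at h
        simpa using h }
  have : FiniteDimensional ℝ (Module.Dual ℂ V) := FiniteDimensional.complexToReal _
  have hinj : Function.Injective Φ := by
    rw [injective_iff_map_eq_zero]
    intro k hk
    exact hφ.eq_zero_of_forall fun f => by simpa [Φ] using LinearMap.congr_fun hk f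
  have hfin : Module.finrank ℝ V = Module.finrank ℝ (Module.Dual ℂ V) := by
    rw [finrank_real_of_complex, finrank_real_of_complex, Subspace.dual_finrank_eq]
  obtain ⟨k, hk⟩ := (LinearMap.injective_iff_surjective_of_finrank_eq_finrank hfin).1 hinj ℓ
  exact ⟨k, fun f => by simpa [Φ] using LinearMap.congr_fun hk f⟩

/-- A subspace with trivial orthogonal complement is everything. -/
theorem IsFinDimPontryagin.eq_top_of_forall {V : Type*} [AddCommGroup V] [Module ℂ V]
    {φ : V →ₗ[ℂ] V →ₗ⋆[ℂ] ℂ} (hφ : IsFinDimPontryagin φ) {W : Submodule ℂ V}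
    (hW : ∀ g, (∀ f ∈ W, φ g f = 0) → g = 0) : W = ⊤ := by
  by_contra hne
  obtain ⟨ℓ, hℓ, hWℓ⟩ := W.exists_le_ker_of_lt_top (lt_top_iff_ne_top.2 hne)
  obtain ⟨k, hk⟩ := hφ.exists_representative ℓ
  apply hℓ
  have : k = 0 := hW k fun f hf => by
    rw [hφ.hermitian f k, hk, LinearMap.mem_ker.1 (hWℓ hf), star_zero]
  ext f
  rw [← hk, this]; simp

/-! ### Multiplication by the variable and evaluation -/

/-- Multiplication by the variable is symmetric in `B`. -/
def MultSymmetric {d : ℕ} {B : Submodule ℂ (VecPoly d)} (φ : B →ₗ[ℂ] B →ₗ⋆[ℂ] ℂ) : Prop :=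
  ∀ f f' g g' : B, (f' : VecPoly d) = mulVar d f → (g' : VecPoly d) = mulVar d g →
    φ f' g = φ f g'

@[simp] theorem evalAt_apply {d : ℕ} (α : ℂ) (f : VecPoly d) (i : Fin d) :
    evalAt d α f i = (f i).eval α := rfl

@[simp] theorem mulVar_apply {d : ℕ} (f : VecPoly d) (i : Fin d) :
    mulVar d f i = X * f i := rfl

theorem vecPoly_ext {d : ℕ} {f g : VecPoly d} (h : ∀ z i, (f i).eval z = (g i).eval z) :
    f = g := funext fun i => Polynomial.funext fun z => h z i

/-- Through this the kernel hypothesis on `B` reaches `B₀`. -/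
theorem MultSymmetric.restrictForm {d : ℕ} {B B₀ : Submodule ℂ (VecPoly d)} (h : B₀ ≤ B)
    {φ : B →ₗ[ℂ] B →ₗ⋆[ℂ] ℂ} (hφ : MultSymmetric φ) : MultSymmetric (restrictForm h φ) :=
  fun f f' g g' hf hg => hφ (Submodule.inclusion h f) (Submodule.inclusion h f')
    (Submodule.inclusion h g) (Submodule.inclusion h g') hf hg

theorem mem_ranMultOpSub {d : ℕ} {B : Submodule ℂ (VecPoly d)} {α : ℂ} {h : B} :
    h ∈ ranMultOpSub B α ↔ ∃ t : B, (h : VecPoly d) = mulVar d t - α • (t : VecPoly d) := by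
  constructor
  · rintro ⟨t, rfl⟩
    exact ⟨⟨t, t.2.1⟩, rfl⟩
  · rintro ⟨t, ht⟩
    have hm : mulVar d t ∈ B := by
      rw [← sub_add_cancel (mulVar d t) (α • (t : VecPoly d)), ← ht]
      exact B.add_mem h.2 (B.smul_mem _ t.2)
    exact ⟨⟨t, t.2, hm⟩, Subtype.ext ht.symm⟩

theorem mem_kerEval {d : ℕ} {B : Submodule ℂ (VecPoly d)} {α : ℂ} {h : B} :
    h ∈ kerEval B α ↔ ∀ i, ((h : VecPoly d) i).eval α = 0 := by
  rw [kerEval, LinearMap.mem_ker]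
  exact funext_iff

theorem ranMultOpSub_le_kerEval {d : ℕ} (B : Submodule ℂ (VecPoly d)) (α : ℂ) :
    ranMultOpSub B α ≤ kerEval B α := by
  intro h hh
  obtain ⟨t, ht⟩ := mem_ranMultOpSub.1 hh
  exact mem_kerEval.2 fun i => by simp [ht]

/-- Consequently the dimension of the range of `S_B - α` does not depend on `α`. -/
theorem multOp_sub_injective {d : ℕ} (B : Submodule ℂ (VecPoly d)) (α : ℂ) :
    Function.Injective
      (multOp B - α • Submodule.inclusion (show multDom B ≤ B from inf_le_left)) := by
  rw [injective_iff_map_eq_zero]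
  intro f hf
  have h : ∀ i, (X - C α) * (f : VecPoly d) i = 0 := fun i => by
    have h1 : mulVar d f - α • (f : VecPoly d) = 0 := congrArg Subtype.val hf
    have h2 := congrFun h1 i
    simpa [sub_mul, Polynomial.smul_eq_C_mul] using h2
  ext1
  funext i
  exact (mul_eq_zero.1 (h i)).resolve_left (X_sub_C_ne_zero α)

/-! ### Passing from a complex point to a real one -/

/-- A nonzero polynomial does not vanish at some real number. -/
theorem exists_real_eval_ne_zero {p : ℂ[X]} (hp : p ≠ 0) : ∃ β : ℝ, p.eval (β : ℂ) ≠ 0 := by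
  by_contra! h
  apply hp
  apply Polynomial.eq_zero_of_infinite_isRoot
  exact (Set.infinite_range_of_injective Complex.ofReal_injective).mono
    (by rintro _ ⟨x, rfl⟩; exact h x)

/-- The rank of the evaluation at some real point is at least that at a given point. -/
theorem exists_real_finrank_range_evalAt_le {d : ℕ} (B : Submodule ℂ (VecPoly d)) (α : ℂ) :
    ∃ β : ℝ, Module.finrank ℂ (LinearMap.range ((evalAt d α).domRestrict B)) ≤
      Module.finrank ℂ (LinearMap.range ((evalAt d (β : ℂ)).domRestrict B)) := by
  set E := (evalAt d α).domRestrict B with hE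
  set r := Module.finrank ℂ (LinearMap.range E)
  let e : LinearMap.range E ≃ₗ[ℂ] (Fin r → ℂ) := (Module.finBasis ℂ _).equivFun
  obtain ⟨s, hs⟩ := E.rangeRestrict.exists_rightInverse_of_surjective E.range_rangeRestrict
  obtain ⟨b, hb⟩ := (LinearMap.range E).subtype.exists_leftInverse_of_injective
    (LinearMap.range E).ker_subtype
  let a : (Fin r → ℂ) →ₗ[ℂ] B := s ∘ₗ e.symm.toLinearMap
  let b' : (Fin d → ℂ) →ₗ[ℂ] (Fin r → ℂ) := e.toLinearMap ∘ₗ b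
  have hid : b' ∘ₗ E ∘ₗ a = LinearMap.id := by
    refine LinearMap.ext fun x => ?_
    have h1 : E (s (e.symm x)) = e.symm x :=
      congrArg Subtype.val (LinearMap.congr_fun hs (e.symm x))
    have h2 : b (e.symm x : Fin d → ℂ) = e.symm x := LinearMap.congr_fun hb (e.symm x)
    simp [a, b', h1, h2]
  -- This compresses evaluation at `z` to an `r × r` matrix that is polynomial in `z` and is the
  -- identity at `z = α`. Where its determinant is nonzero, the rank of evaluation is at least `r`.
  let P : Matrix (Fin r) (Fin r) ℂ[X] := Matrix.of fun i j =>
    ∑ k, C (LinearMap.toMatrix' b' i k) * (a (Pi.single j 1) : VecPoly d) k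
  have hP : ∀ z : ℂ, P.map (Polynomial.eval z) =
      LinearMap.toMatrix' (b' ∘ₗ (evalAt d z).domRestrict B ∘ₗ a) := by
    intro z
    ext i j
    have h1 : b' (evalAt d z (a (Pi.single j 1))) i =
        (LinearMap.toMatrix' b').mulVec (evalAt d z (a (Pi.single j 1))) i := by
      rw [LinearMap.toMatrix'_mulVec]
    rw [LinearMap.toMatrix'_apply]
    refine Eq.trans ?_ h1.symm
    simp [P, Polynomial.eval_finsetSum, Matrix.mulVec, dotProduct]
  have hdet : ∀ z : ℂ, P.det.eval z =
      (LinearMap.toMatrix' (b' ∘ₗ (evalAt d z).domRestrict B ∘ₗ a)).det := by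
    intro z
    rw [← hP z, ← Polynomial.coe_evalRingHom, RingHom.map_det]
    rfl
  have hne : P.det ≠ 0 := by
    intro h0
    have := hdet α
    rw [h0, ← hE, hid] at this
    simp at this
  obtain ⟨β, hβ⟩ := exists_real_eval_ne_zero hne
  refine ⟨β, ?_⟩
  rw [hdet β] at hβ
  set F := (evalAt d (β : ℂ)).domRestrict B
  have hinj : Function.Injective (F ∘ₗ a) := by
    rw [injective_iff_map_eq_zero]
    intro x hx
    refine Matrix.eq_zero_of_mulVec_eq_zero hβ ?_
    rw [LinearMap.toMatrix'_mulVec]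
    simp only [LinearMap.comp_apply] at hx ⊢
    rw [hx, map_zero]
  calc r = Module.finrank ℂ (LinearMap.range (F ∘ₗ a)) := by
        rw [LinearMap.finrank_range_of_inj hinj]; simp
    _ ≤ _ := Submodule.finrank_mono (LinearMap.range_comp_le_range _ _)

/-- The range condition at one point implies the range condition at a real point. -/
theorem exists_real_ranMultOpSub_eq_kerEval {d : ℕ} {B : Submodule ℂ (VecPoly d)}
    [FiniteDimensional ℂ B] {α : ℂ} (h : ranMultOpSub B α = kerEval B α) :
    ∃ β : ℝ, ranMultOpSub B β = kerEval B β := by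
  obtain ⟨β, hβ⟩ := exists_real_finrank_range_evalAt_le B α
  refine ⟨β, Submodule.eq_of_le_of_finrank_le (ranMultOpSub_le_kerEval B β) ?_⟩
  have : FiniteDimensional ℂ (multDom B) :=
    Submodule.finiteDimensional_of_le (show multDom B ≤ B from inf_le_left)
  have hr (z : ℂ) : Module.finrank ℂ (LinearMap.range ((evalAt d z).domRestrict B)) +
      Module.finrank ℂ (kerEval B z) = Module.finrank ℂ B :=
    LinearMap.finrank_range_add_finrank_ker _
  have hm (z : ℂ) : Module.finrank ℂ (ranMultOpSub B z) = Module.finrank ℂ (multDom B) :=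
    LinearMap.finrank_range_of_inj (multOp_sub_injective B z)
  -- The range has constant dimension, while the kernel of evaluation at `β` is no larger than that
  -- at `α`.
  have h1 := hr α
  have h2 := hr β
  rw [← h, hm] at h1
  rw [hm]
  omega

/-! ### From symmetric division to a Nevanlinna kernel -/

/-- Symmetry of multiplication by the variable, shifted by a real number. -/
theorem MultSymmetric.apply_sub {d : ℕ} {B : Submodule ℂ (VecPoly d)}
    {φ : B →ₗ[ℂ] B →ₗ⋆[ℂ] ℂ} (hs : MultSymmetric φ) (β : ℝ) {t h t' h' : B}
    (ht : (h : VecPoly d) = mulVar d t - (β : ℂ) • (t : VecPoly d))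
    (ht' : (h' : VecPoly d) = mulVar d t' - (β : ℂ) • (t' : VecPoly d)) :
    φ t h' = φ h t' := by
  have := hs t (h + (β : ℂ) • t) t' (h' + (β : ℂ) • t') (by simp [ht]) (by simp [ht'])
  simp only [map_add, LinearMap.add_apply, map_smul, LinearMap.smul_apply,
    LinearMap.map_smulₛₗ, Complex.conj_ofReal] at this
  exact (add_right_cancel this).symm

/-- Every linear map between vector spaces has a generalized inverse. -/
theorem LinearMap.exists_generalizedInverse {k V W : Type*} [Field k] [AddCommGroup V] [Module k V]
    [AddCommGroup W] [Module k W] (E : V →ₗ[k] W) : ∃ Q : W →ₗ[k] V, ∀ f, E (Q (E f)) = E f := by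
  obtain ⟨s, hs⟩ := E.rangeRestrict.exists_rightInverse_of_surjective E.range_rangeRestrict
  obtain ⟨b, hb⟩ := (LinearMap.range E).subtype.exists_leftInverse_of_injective
    (LinearMap.range E).ker_subtype
  refine ⟨s ∘ₗ b, fun f => ?_⟩
  have h1 : b (E f) = E.rangeRestrict f := LinearMap.congr_fun hb (E.rangeRestrict f)
  have h2 := congrArg Subtype.val (LinearMap.congr_fun hs (E.rangeRestrict f))
  simpa [h1] using h2

/-- The range condition provides a division operator: subtract from `f` the element
`Q (f(α))` with the same value at `α` and divide by `z - α`. -/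
theorem exists_divisionOperator {d : ℕ} {B : Submodule ℂ (VecPoly d)} {α : ℂ}
    (h : ranMultOpSub B α = kerEval B α) {Q : (Fin d → ℂ) →ₗ[ℂ] B}
    (hQ : ∀ f : B, evalAt d α (Q (evalAt d α f)) = evalAt d α f) :
    ∃ A : B →ₗ[ℂ] B, ∀ f : B, ((f - Q (evalAt d α f) : B) : VecPoly d) =
      mulVar d (A f) - α • (A f : VecPoly d) := by
  let E := (evalAt d α).domRestrict B
  let D := multOp B - α • Submodule.inclusion (show multDom B ≤ B from inf_le_left)
  let e : multDom B ≃ₗ[ℂ] LinearMap.range D := LinearEquiv.ofInjective D (multOp_sub_injective B α)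
  have hmem : ∀ f, (LinearMap.id - Q ∘ₗ E : B →ₗ[ℂ] B) f ∈ LinearMap.range D := fun f => by
    change _ ∈ ranMultOpSub B α
    rw [h, kerEval, LinearMap.mem_ker, LinearMap.sub_apply, map_sub, sub_eq_zero]
    exact (hQ f).symm
  let A : B →ₗ[ℂ] B := Submodule.inclusion (show multDom B ≤ B from inf_le_left) ∘ₗ
    e.symm.toLinearMap ∘ₗ (LinearMap.id - Q ∘ₗ E : B →ₗ[ℂ] B).codRestrict _ hmem
  refine ⟨A, fun f => ?_⟩
  have h1 : D (e.symm ⟨_, hmem f⟩) = (LinearMap.id - Q ∘ₗ E : B →ₗ[ℂ] B) f :=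
    congrArg Subtype.val (e.apply_symm_apply ⟨_, hmem f⟩)
  exact (congrArg Subtype.val h1).symm

theorem matEval_apply {d : ℕ} (M : Matrix (Fin d) (Fin d) ℂ[X]) (z : ℂ) (i j : Fin d) :
    matEval M z i j = (M i j).eval z := rfl

theorem rank_fromCols_zero_one (d : ℕ) :
    (Matrix.fromCols (0 : Matrix (Fin d) (Fin d) ℂ) (1 : Matrix (Fin d) (Fin d) ℂ)).rank = d := by
  apply le_antisymm
  · exact (Matrix.rank_le_card_height _).trans_eq (Fintype.card_fin d)
  · have h1 : Matrix.fromCols (0 : Matrix (Fin d) (Fin d) ℂ) (1 : Matrix (Fin d) (Fin d) ℂ) *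
        Matrix.fromRows (0 : Matrix (Fin d) (Fin d) ℂ) (1 : Matrix (Fin d) (Fin d) ℂ) = 1 := by
      rw [Matrix.fromCols_mul_fromRows, Matrix.mul_one, Matrix.mul_zero, zero_add]
    have h2 := Matrix.rank_mul_le_left (Matrix.fromCols (0 : Matrix (Fin d) (Fin d) ℂ)
      (1 : Matrix (Fin d) (Fin d) ℂ)) (Matrix.fromRows (0 : Matrix (Fin d) (Fin d) ℂ)
      (1 : Matrix (Fin d) (Fin d) ℂ))
    rwa [h1, Matrix.rank_one, Fintype.card_fin] at h2

open scoped Matrix in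
/-- If multiplication by the variable is symmetric and satisfies the range condition at a real
point, then the reproducing kernel is a Nevanlinna kernel. -/
theorem hasNevanlinnaReproducingKernel_of_range {d : ℕ} {B : Submodule ℂ (VecPoly d)}
    {φ : B →ₗ[ℂ] B →ₗ⋆[ℂ] ℂ} (hφ : IsFinDimPontryagin φ) (hs : MultSymmetric φ) {β : ℝ}
    (h : ranMultOpSub B β = kerEval B β) : HasNevanlinnaReproducingKernel B φ := by
  obtain ⟨Q, hQ⟩ := ((evalAt d (β : ℂ)).domRestrict B).exists_generalizedInverse
  replace hQ : ∀ f : B, evalAt d β (Q (evalAt d β f)) = evalAt d β f := hQ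
  obtain ⟨A, hA⟩ := exists_divisionOperator h hQ
  have hker : ∀ (w : ℂ) (j : Fin d), ∃ k : B, ∀ f : B, φ f k = ((f : VecPoly d) j).eval w :=
    fun w j => hφ.exists_representative
      ((LinearMap.proj j ∘ₗ evalAt d w).domRestrict B)
  choose k hk using hker
  let q : Fin d → B := fun l => Q (Pi.single l 1)
  have hQsum : ∀ y, Q y = ∑ l, y l • q l := fun y => by
    conv_lhs => rw [pi_eq_sum_univ' y]
    simp [q]
  -- `g l` is the adjoint of the division operator `A` applied to `q l`.
  choose g hg using fun l : Fin d => hφ.exists_representative ((φ.flip (q l)) ∘ₗ A)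
  replace hg : ∀ l f, φ f (g l) = φ (A f) (q l) := hg
  have green : ∀ f f' : B, φ (A f) f' - φ f (A f') =
      φ (A f) (Q (evalAt d β f')) - φ (Q (evalAt d β f)) (A f') := fun f f' => by
    have := hs.apply_sub β (hA f) (hA f')
    simp only [map_sub, LinearMap.sub_apply] at this
    linear_combination this
  have hsym : ∀ w v i j, ((k v j : VecPoly d) i).eval w =
      star (((k w i : VecPoly d) j).eval v) := fun w v i j => by
    rw [← hk w i, ← hk v j, hφ.hermitian]
  -- `P = 1 - E_β Q` annihilates all values `f(β)`. Adding it to `N` leaves the kernel unchanged and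
  -- gives `N(β) = 1`, even if evaluation at `β` is not onto.
  let P : Matrix (Fin d) (Fin d) ℂ := Matrix.of fun i l => (if i = l then 1 else 0) -
    ((q l : VecPoly d) i).eval (β : ℂ)
  have hP : ∀ (f : B) i, ∑ l, P i l * ((f : VecPoly d) l).eval (β : ℂ) = 0 := fun f i => by
    have h1 := congrFun (hQ f) i
    rw [hQsum] at h1
    simp only [evalAt_apply, Submodule.coe_sum, Submodule.coe_smul, Finset.sum_apply,
      Pi.smul_apply, Polynomial.eval_finsetSum, Polynomial.eval_smul, smul_eq_mul] at h1
    simp only [P, Matrix.of_apply, sub_mul, ite_mul, one_mul, zero_mul, Finset.sum_sub_distrib,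
      Finset.sum_ite_eq, Finset.mem_univ, if_true]
    rw [sub_eq_zero, ← h1]
    exact Finset.sum_congr rfl fun l _ => mul_comm _ _
  let M : Matrix (Fin d) (Fin d) ℂ[X] := Matrix.of fun i l => (X - C (β : ℂ)) * (k β l : VecPoly d) i
  let N : Matrix (Fin d) (Fin d) ℂ[X] := Matrix.of fun i l =>
    (q l : VecPoly d) i - (X - C (β : ℂ)) * (g l : VecPoly d) i + C (P i l)
  have hdiv : ∀ (f : B) i w, ((f : VecPoly d) i).eval w = (w - β) * ((A f : VecPoly d) i).eval w +
      ∑ l, ((f : VecPoly d) l).eval (β : ℂ) * ((q l : VecPoly d) i).eval w := fun f i w => by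
    have h1 := congrArg (fun p : VecPoly d => (p i).eval w) (hA f)
    rw [hQsum] at h1
    simp only [Submodule.coe_sub, Submodule.coe_sum, Submodule.coe_smul, Finset.sum_apply,
      Pi.smul_apply, Pi.sub_apply, Polynomial.eval_sub, Polynomial.eval_finsetSum,
      Polynomial.eval_smul, smul_eq_mul, mulVar_apply, Polynomial.eval_mul, Polynomial.eval_X,
      evalAt_apply] at h1
    linear_combination h1
  have hAQ : ∀ f y, φ (A f) (Q y) = ∑ l, star (y l) * φ f (g l) := fun f y => by
    simp only [hQsum, map_sum, LinearMap.map_smulₛₗ, ← hg, smul_eq_mul, starRingEnd_apply]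
  have hgs : ∀ l w i, φ (k w i) (g l) = star (((g l : VecPoly d) i).eval w) := fun l w i => by
    rw [hφ.hermitian (g l), hk]
  have key : ∀ w v i j, (w - star v) * ((k v j : VecPoly d) i).eval w =
      ∑ l, ((M i l).eval w * star ((N j l).eval v) - (N i l).eval w * star ((M j l).eval v)) := by
    intro w v i j
    let c l := ((k β l : VecPoly d) i).eval w
    let c' l := star (((k β l : VecPoly d) j).eval v)
    let q₀ l := ((q l : VecPoly d) i).eval w
    let q' l := star (((q l : VecPoly d) j).eval v)
    let g₀ l := ((g l : VecPoly d) i).eval w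
    let g' l := star (((g l : VecPoly d) j).eval v)
    let p l := P i l
    let p' l := star (P j l)
    let a := ((A (k v j) : VecPoly d) i).eval w
    let a' := star (((A (k w i) : VecPoly d) j).eval v)
    have hc' : ∀ l, ((k v j : VecPoly d) l).eval (β : ℂ) = c' l := fun l => hsym _ _ _ _
    have hc : ∀ l, star (((k w i : VecPoly d) l).eval (β : ℂ)) = c l := fun l => (hsym _ _ _ _).symm
    have hβ : star (β : ℂ) = β := Complex.conj_ofReal β
    have e1 : ((k v j : VecPoly d) i).eval w = (w - β) * a + ∑ l, c' l * q₀ l := by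
      rw [hdiv]
      simp only [hc', a, q₀]
    have e2 : ((k v j : VecPoly d) i).eval w = (star v - β) * a' + ∑ l, c l * q' l := by
      rw [hsym, hdiv, star_add, star_mul', star_sub, hβ, star_sum]
      simp only [star_mul', hc, a', q']
    have e3 : a - a' = ∑ l, c l * g' l - ∑ l, c' l * g₀ l := by
      have h1 := green (k v j) (k w i)
      rw [hk, hφ.hermitian (A (k w i)) (k v j), hk, hφ.hermitian (A (k w i)) (Q _), hAQ, hAQ,
        star_sum] at h1
      simpa only [evalAt_apply, star_mul', star_star, hgs, hc, hc'] using h1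
    have e4 : ∑ l, p l * c' l = 0 := by
      simpa only [hc'] using hP (k v j) i
    have e5 : ∑ l, p' l * c l = 0 := by
      have h1 := congrArg star (hP (k w i) j)
      rw [star_sum, star_zero] at h1
      simpa only [star_mul', hc] using h1
    have hM : ∀ l, (M i l).eval w = (w - β) * c l := fun l => by simp [M, c]
    have hM' : ∀ l, star ((M j l).eval v) = (star v - β) * c' l := fun l => by
      simp [M, c']
    have hN : ∀ l, (N i l).eval w = q₀ l - (w - β) * g₀ l + p l := fun l => by
      simp [N, q₀, g₀, p]
    have hN' : ∀ l, star ((N j l).eval v) = q' l - (star v - β) * g' l + p' l := fun l => by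
      simp [N, q', g', p']
    have hsum : ∀ (x y : ℂ) (c g q p c' g' q' p' : Fin d → ℂ),
        ∑ l, (x * c l * (q' l - y * g' l + p' l) - (q l - x * g l + p l) * (y * c' l)) =
        x * ∑ l, c l * q' l - x * y * (∑ l, c l * g' l) + x * (∑ l, p' l * c l) -
          y * (∑ l, c' l * q l) + x * y * (∑ l, c' l * g l) - y * ∑ l, p l * c' l := by
      intros
      simp only [Finset.mul_sum, ← Finset.sum_add_distrib, ← Finset.sum_sub_distrib]
      exact Finset.sum_congr rfl fun l _ => by ring
    simp only [hM, hM', hN, hN']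
    -- `e1` and `e2` divide the kernel by `z - β` in each variable; Green's identity `e3` eliminates
    -- the quotients `a` and `a'`.
    rw [hsum]
    linear_combination (w - β) * e2 - (star v - β) * e1 - (w - β) * (star v - β) * e3 -
      (w - β) * e5 + (star v - β) * e4
  refine ⟨fun z w => Matrix.of fun i j => ((k w j : VecPoly d) i).eval z, fun w x =>
    ⟨∑ j, x j • k w j, fun z => ?_, fun f => ?_⟩, M, N, fun z w hzw => ?_, fun z => ?_, β, ?_⟩
  · ext i
    simp [Matrix.mulVec, dotProduct, Polynomial.eval_finsetSum, mul_comm]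
  · simp [dotProduct, hk, LinearMap.map_smulₛₗ]
  · ext i j
    rw [Matrix.smul_apply, smul_eq_mul, eq_inv_mul_iff_mul_eq₀ (sub_ne_zero.2 hzw)]
    refine (key z w i j).trans ?_
    simp only [Finset.sum_sub_distrib, Matrix.sub_apply, Matrix.mul_apply, matEval_apply,
      Matrix.conjTranspose_apply]
  · ext i j
    have := key z (star z) i j
    rw [star_star, sub_self, zero_mul] at this
    rw [Finset.sum_sub_distrib] at this
    simp only [Matrix.sub_apply, Matrix.mul_apply, matEval_apply, Matrix.conjTranspose_apply,
      ← this, Matrix.zero_apply]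
  · have hM : matEval M β = 0 := by ext i j; rw [matEval_apply]; simp [M]
    have hN : matEval N β = 1 := by ext i j; rw [matEval_apply]; simp [N, P, Matrix.one_apply, apply_ite (Polynomial.eval (β : ℂ))]
    rw [hM, hN]
    exact rank_fromCols_zero_one d

/-! ### From a Nevanlinna kernel to symmetric division -/

open scoped Matrix in
/-- Exactness of a Lagrangian pair of matrices of full rank. -/
theorem Matrix.exists_of_mulVec_eq_of_lagrangian {n : Type*} [Fintype n] [DecidableEq n]
    {M N U V : Matrix n n ℂ} (h1 : M * U + N * V = 1) (h2 : M * Nᴴ - N * Mᴴ = 0)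
    {a b : n → ℂ} (hab : M *ᵥ a = N *ᵥ b) : ∃ y, a = Nᴴ *ᵥ y ∧ b = Mᴴ *ᵥ y := by
  have h3 : Uᴴ * Mᴴ + Vᴴ * Nᴴ = 1 := by
    rw [← Matrix.conjTranspose_mul, ← Matrix.conjTranspose_mul, ← Matrix.conjTranspose_add, h1,
      Matrix.conjTranspose_one]
  -- `Z` completes `[M, -N]` to an invertible square matrix. With `y` as below, `(a, b)` and `(Nᴴ y,
  -- Mᴴ y)` have the same image under `Z`.
  let Z := Matrix.fromBlocks M (-N) Vᴴ Uᴴ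
  have hZ : Z * Matrix.fromBlocks U Nᴴ (-V) Mᴴ =
      Matrix.fromBlocks 1 0 (Vᴴ * U - Uᴴ * V) 1 := by
    rw [Matrix.fromBlocks_multiply]
    congr 1
    · simpa using h1
    · rw [← h2, Matrix.neg_mul, sub_eq_add_neg]
    · rw [Matrix.mul_neg, sub_eq_add_neg]
    · rw [← h3, add_comm]
  have hdet : Z.det ≠ 0 := by
    have := congrArg Matrix.det hZ
    rw [Matrix.det_mul, Matrix.det_fromBlocks_zero₁₂, Matrix.det_one, mul_one] at this
    exact left_ne_zero_of_mul (this ▸ one_ne_zero)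
  let y := Vᴴ *ᵥ a + Uᴴ *ᵥ b
  have h4 : Z *ᵥ (Sum.elim a b - Sum.elim (Nᴴ *ᵥ y) (Mᴴ *ᵥ y)) = 0 := by
    rw [Matrix.mulVec_sub, sub_eq_zero, Matrix.fromBlocks_mulVec, Matrix.fromBlocks_mulVec]
    simp only [Sum.elim_comp_inl, Sum.elim_comp_inr, Matrix.mulVec_mulVec, Matrix.neg_mulVec]
    congr 1
    · rw [hab, add_neg_cancel, Matrix.neg_mul, ← Matrix.add_mulVec, ← sub_eq_add_neg, h2,
        Matrix.zero_mulVec]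
    · rw [← Matrix.add_mulVec, add_comm (Vᴴ * Nᴴ), h3, Matrix.one_mulVec]
  have h5 := sub_eq_zero.1 (Matrix.eq_zero_of_mulVec_eq_zero hdet h4)
  exact ⟨y, funext fun i => congrFun h5 (Sum.inl i), funext fun i => congrFun h5 (Sum.inr i)⟩

/-- A pair of matrix polynomials that has full rank at one point is right invertible at some real
point. -/
theorem exists_real_rightInverse {d : ℕ} {M N : Matrix (Fin d) (Fin d) ℂ[X]} {z : ℂ}
    (h : (Matrix.fromCols (matEval M z) (matEval N z)).rank = d) :
    ∃ (β : ℝ) (U V : Matrix (Fin d) (Fin d) ℂ), matEval M β * U + matEval N β * V = 1 := by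
  have hsurj : Function.Surjective (Matrix.fromCols (matEval M z) (matEval N z)).mulVec := by
    rw [← Matrix.coe_mulVecLin, ← LinearMap.range_eq_top]
    apply Submodule.eq_top_of_finrank_eq
    rw [← Matrix.rank, h]; simp
  obtain ⟨G, hG⟩ := Matrix.mulVec_surjective_iff_exists_right_inverse.1 hsurj
  rw [← Matrix.fromRows_toRows G, Matrix.fromCols_mul_fromRows] at hG
  -- The right inverse at `z`, kept constant, still gives an invertible product wherever `P.det` is
  -- nonzero.
  let P := M * G.toRows₁.map C + N * G.toRows₂.map C
  have hP : ∀ w, P.det.eval w = (matEval M w * G.toRows₁ + matEval N w * G.toRows₂).det := by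
    intro w
    rw [← Polynomial.coe_evalRingHom, RingHom.map_det]
    congr 1
    ext i j
    simp [P, Matrix.mul_apply, matEval_apply, Polynomial.eval_finsetSum]
  obtain ⟨β, hβ⟩ := exists_real_eval_ne_zero (p := P.det) fun h0 => by
    have := hP z
    rw [hG, h0] at this
    simp at this
  rw [hP] at hβ
  refine ⟨β, G.toRows₁ * (matEval M β * G.toRows₁ + matEval N β * G.toRows₂)⁻¹,
    G.toRows₂ * (matEval M β * G.toRows₁ + matEval N β * G.toRows₂)⁻¹, ?_⟩
  rw [← Matrix.mul_assoc, ← Matrix.mul_assoc, ← Matrix.add_mul]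
  exact Matrix.mul_nonsing_inv _ (isUnit_iff_ne_zero.2 hβ)

open scoped Matrix in
/-- If the reproducing kernel is a Nevanlinna kernel, then elements vanishing at a suitable real
point can be divided within the space, and the division is symmetric. -/
theorem exists_real_symmetric_division {d : ℕ} {B : Submodule ℂ (VecPoly d)}
    {φ : B →ₗ[ℂ] B →ₗ⋆[ℂ] ℂ} (hφ : IsFinDimPontryagin φ)
    (hK : HasNevanlinnaReproducingKernel B φ) :
    ∃ β : ℝ, ∀ f ∈ kerEval B β, ∃ t : B,
      (f : VecPoly d) = mulVar d t - (β : ℂ) • (t : VecPoly d) ∧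
      ∀ h s : B, (h : VecPoly d) = mulVar d s - (β : ℂ) • (s : VecPoly d) → φ h t = φ s f := by
  obtain ⟨K, hrep, M, N, hK1, hK2, z₀, hz₀⟩ := hK
  obtain ⟨β, U, V, hUV⟩ := exists_real_rightInverse hz₀
  have hK' : ∀ z w, (z - star w) • K z w =
      matEval M z * (matEval N w)ᴴ - matEval N z * (matEval M w)ᴴ := fun z w => by
    by_cases hzw : z = star w
    · have := hK2 z
      rw [hzw, star_star] at this
      rw [hzw, this, sub_self, zero_smul]
    · rw [hK1 z w hzw, smul_inv_smul₀ (sub_ne_zero.2 hzw)]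
  -- Kernel functions at `w = β` are left out so that `star w - β` is invertible. The rest still
  -- span: anything orthogonal to them vanishes off `β`, hence everywhere.
  let W : Set B := {k | ∃ w x, w ≠ (β : ℂ) ∧ (∀ z : ℂ, evalAt d z k = (K z w).mulVec x) ∧
    ∀ f : B, φ f k = dotProduct (star x) (evalAt d w f)}
  have hW : Submodule.span ℂ W = ⊤ := by
    refine hφ.eq_top_of_forall fun g hg => ?_
    have h0 : ∀ w ≠ (β : ℂ), ∀ i, ((g : VecPoly d) i).eval w = 0 := fun w hw i => by
      obtain ⟨k, hk1, hk2⟩ := hrep w (Pi.single i 1)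
      have := hg k (Submodule.subset_span ⟨w, _, hw, hk1, hk2⟩)
      rw [hk2, ← Pi.single_star] at this
      simpa using this
    ext1
    funext i
    refine Polynomial.eq_zero_of_infinite_isRoot _
      ((Set.finite_singleton (β : ℂ)).infinite_compl.mono fun w hw => h0 w hw i)
  have hrepr : ∀ f : B, ∃ (g : B) (a b : Fin d → ℂ),
      (∀ z, evalAt d z f = (z - β) • evalAt d z g + (matEval M z *ᵥ a - matEval N z *ᵥ b)) ∧
      ∀ h s : B, (h : VecPoly d) = mulVar d s - (β : ℂ) • (s : VecPoly d) → φ h g = φ s f := by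
    intro f
    have hf : f ∈ Submodule.span ℂ W := hW ▸ Submodule.mem_top
    induction hf using Submodule.span_induction with
    | mem k hk =>
      obtain ⟨w, x, hw, hk1, hk2⟩ := hk
      have hw' : star w - (β : ℂ) ≠ 0 := fun h0 => hw (by
        rw [← star_star w, sub_eq_zero.1 h0]; exact Complex.conj_ofReal β)
      -- The witnesses come from splitting `z - star w = (z - β) - (star w - β)` in the kernel
      -- formula and solving for `K(z, w) x`.
      refine ⟨(star w - (β : ℂ))⁻¹ • k, -(star w - (β : ℂ))⁻¹ • ((matEval N w)ᴴ *ᵥ x),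
        -(star w - (β : ℂ))⁻¹ • ((matEval M w)ᴴ *ᵥ x), fun z => ?_, fun h s hs => ?_⟩
      · rw [Matrix.mulVec_smul, Matrix.mulVec_smul, ← smul_sub, Matrix.mulVec_mulVec,
          Matrix.mulVec_mulVec, ← Matrix.sub_mulVec, ← hK', Matrix.smul_mulVec, ← hk1,
          Submodule.coe_smul, map_smul, smul_smul, smul_smul, ← add_smul]
        rw [show (z - ↑β) * (star w - ↑β)⁻¹ + -(star w - ↑β)⁻¹ * (z - star w) = 1 by
          field_simp; ring, one_smul]
      · rw [LinearMap.map_smulₛₗ, hk2, hk2, hs, map_sub, map_smul]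
        have : evalAt d w (mulVar d s) = w • evalAt d w s := by ext; simp
        have hw2 : w - (β : ℂ) ≠ 0 := sub_ne_zero.2 hw
        rw [this, ← sub_smul, dotProduct_smul, smul_eq_mul, smul_eq_mul]
        simp only [map_inv₀, map_sub, Complex.conj_ofReal, Complex.star_def, Complex.conj_conj]
        rw [inv_mul_cancel_left₀ hw2]
    | zero => exact ⟨0, 0, 0, by simp, by simp⟩
    | add f₁ f₂ _ _ h₁ h₂ =>
      obtain ⟨g₁, a₁, b₁, e₁, s₁⟩ := h₁
      obtain ⟨g₂, a₂, b₂, e₂, s₂⟩ := h₂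
      refine ⟨g₁ + g₂, a₁ + a₂, b₁ + b₂, fun z => ?_, fun h s hs => ?_⟩
      · simp only [Submodule.coe_add, map_add, e₁, e₂, Matrix.mulVec_add, smul_add]
        abel
      · rw [map_add, map_add, s₁ h s hs, s₂ h s hs]
    | smul c f _ h₁ =>
      obtain ⟨g, a, b, e, s₁⟩ := h₁
      refine ⟨c • g, c • a, c • b, fun z => ?_, fun h s hs => ?_⟩
      · simp only [Submodule.coe_smul, map_smul, e, Matrix.mulVec_smul, smul_add, smul_sub,
          smul_comm c]
      · rw [LinearMap.map_smulₛₗ, LinearMap.map_smulₛₗ, s₁ h s hs]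
  refine ⟨β, fun f hf => ?_⟩
  obtain ⟨g, a, b, e, s₁⟩ := hrepr f
  have hβ : star (β : ℂ) = β := Complex.conj_ofReal β
  have hf0 : evalAt d (β : ℂ) f = 0 := hf
  have hab : matEval M β *ᵥ a = matEval N β *ᵥ b := by
    have := e β
    rwa [hf0, sub_self, zero_smul, zero_add, eq_comm, sub_eq_zero] at this
  have hlag := hK2 β
  rw [hβ] at hlag
  obtain ⟨y, rfl, rfl⟩ := Matrix.exists_of_mulVec_eq_of_lagrangian hUV hlag hab
  obtain ⟨k, hk1, hk2⟩ := hrep β y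
  -- With `a = N(β)ᴴ y` and `b = M(β)ᴴ y`, the remainder `M a - N b` is `(z - β) k`. Adding `k`
  -- keeps the symmetry, since `h(β) = 0` makes `k` orthogonal to `h`.
  refine ⟨g + k, vecPoly_ext fun z i => ?_, fun h s hs => ?_⟩
  · have h1 := e z
    rw [Matrix.mulVec_mulVec, Matrix.mulVec_mulVec, ← Matrix.sub_mulVec, ← hK', hβ,
      Matrix.smul_mulVec, ← hk1] at h1
    have h2 := congrFun h1 i
    simp only [evalAt_apply, Pi.add_apply, Pi.smul_apply, smul_eq_mul] at h2
    simp [h2]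
    ring
  · have h0 : evalAt d (β : ℂ) h = 0 := ranMultOpSub_le_kerEval B β (mem_ranMultOpSub.2 ⟨s, hs⟩)
    rw [map_add, s₁ h s hs, hk2, h0, dotProduct_zero, add_zero]

/-! ### Consequences of symmetric division and the equivalence -/

/-- The range condition holds at a real point if the reproducing kernel is a Nevanlinna kernel. -/
theorem exists_ranMultOpSub_eq_kerEval_of_hasNevanlinna {d : ℕ} {B : Submodule ℂ (VecPoly d)}
    {φ : B →ₗ[ℂ] B →ₗ⋆[ℂ] ℂ} (hφ : IsFinDimPontryagin φ)
    (hK : HasNevanlinnaReproducingKernel B φ) :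
    ∃ β : ℝ, ranMultOpSub B β = kerEval B β := by
  obtain ⟨β, hβ⟩ := exists_real_symmetric_division hφ hK
  refine ⟨β, le_antisymm (ranMultOpSub_le_kerEval B β) fun f hf => ?_⟩
  obtain ⟨t, ht, -⟩ := hβ f hf
  exact mem_ranMultOpSub.2 ⟨t, ht⟩

/-- Multiplication by the variable is symmetric if the reproducing kernel is a Nevanlinna
kernel. -/
theorem multSymmetric_of_hasNevanlinna {d : ℕ} {B : Submodule ℂ (VecPoly d)}
    {φ : B →ₗ[ℂ] B →ₗ⋆[ℂ] ℂ} (hφ : IsFinDimPontryagin φ)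
    (hK : HasNevanlinnaReproducingKernel B φ) : MultSymmetric φ := by
  obtain ⟨β, hβ⟩ := exists_real_symmetric_division hφ hK
  intro f f' g g' hf hg
  have hg1 : ((g' - (β : ℂ) • g : B) : VecPoly d) = mulVar d g - (β : ℂ) • (g : VecPoly d) := by
    simp [hg]
  have hf1 : ((f' - (β : ℂ) • f : B) : VecPoly d) = mulVar d f - (β : ℂ) • (f : VecPoly d) := by
    simp [hf]
  obtain ⟨t, ht, hsym⟩ := hβ _ (ranMultOpSub_le_kerEval B β (mem_ranMultOpSub.2 ⟨g, hg1⟩))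
  -- Quotients by `z - β` are unique, so the symmetry of the division applies to `g` itself.
  have htg : t = g := by
    ext1
    funext i
    have h1 := congrFun (ht.symm.trans hg1) i
    simp only [Pi.sub_apply, mulVar_apply, Pi.smul_apply, Polynomial.smul_eq_C_mul,
      ← sub_mul] at h1
    exact mul_left_cancel₀ (X_sub_C_ne_zero _) h1
  have h2 := hsym _ f hf1
  rw [htg] at h2
  simp only [map_sub, LinearMap.sub_apply, map_smul, LinearMap.smul_apply,
    LinearMap.map_smulₛₗ, Complex.conj_ofReal] at h2
  exact sub_left_inj.1 h2

theorem corollary6p4 {d : ℕ} (B : Submodule ℂ (VecPoly d)) (φ : B →ₗ[ℂ] B →ₗ⋆[ℂ] ℂ)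
    (hB : IsFinDimPontryagin φ) (hK : HasNevanlinnaReproducingKernel B φ)
    (B₀ : Submodule ℂ (VecPoly d)) (h₀ : B₀ ≤ B)
    (hB₀ : IsFinDimPontryagin (restrictForm h₀ φ)) :
    HasNevanlinnaReproducingKernel B₀ (restrictForm h₀ φ) ↔
      ∃ α : ℂ, ranMultOpSub B₀ α = kerEval B₀ α := by
  constructor
  · intro h
    obtain ⟨β, hβ⟩ := exists_ranMultOpSub_eq_kerEval_of_hasNevanlinna hB₀ h
    exact ⟨β, hβ⟩
  · rintro ⟨α, hα⟩
    have := hB₀.finiteDimensional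
    obtain ⟨β, hβ⟩ := exists_real_ranMultOpSub_eq_kerEval hα
    exact hasNevanlinnaReproducingKernel_of_range hB₀
      ((multSymmetric_of_hasNevanlinna hB hK).restrictForm h₀) hβ
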